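/- Write $\mathbb R_{++}=(0,\infty)$, let $b(\eta)=\int x\,\eta(dx)$ denote the barycenter of a probability $\eta$ on $\mathbb R_{++}$, and let $\mu,\nu$ be probabilities on $\mathbb R_{++}$ with finite first moments. $\mathscr M(\mu,\nu)$ is the set of probabilities $\pi$ on $\mathbb R_{++}^2$ with marginals $\mu,\nu$ and $b(\pi_{x_0})=x_0$ for $\mu$-a.e. $x_0$. A *source* is a probability $\hat\mu$ on $\mathbb R_{++}\times[0,1]$ with finite first moment whose second marginal has no atoms. For probabilities $\sigma$ on $\mathbb R_{++}\times[0,1]$ and $\eta$ on $\mathbb R_{++}$ with finite first moments, $\hat{\mathscr M}(\sigma,\eta)$ is the set of laws $\alpha$ of triples $(x_0,u,x_1)\in\mathbb R_{++}\times[0,1]\times\mathbb R_{++}$ such that $(x_0,u)\sim\sigma$, $x_1\sim\eta$ and $b(\alpha_{(x_0,u)})=x_0$ $\alpha$-a.s. (Subscripts denote disintegrations.) For a source $\hat\mu$ put $$C^{\hat\mu}(\eta)=\inf_{\alpha\in\hat{\mathscr M}(\delta_m\otimes\hat\mu_m,\,\eta)}\int(1-u)\sqrt{1+x_1^2}\;d\alpha,\qquad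 m=b(\eta).$$ If $\hat\mu$ has first marginal $\mu$, then $\pi\in\mathscr M(\mu,\nu)$ is called *the shadow coupling between $\mu$ and $\nu$ with source $\hat\mu$* if it is the unique minimizer of $\pi\mapsto\int C^{\hat\mu}(\pi_{x_0})\,\mu(dx_0)$ over $\mathscr M(\mu,\nu)$. It is called *left-monotone*, *right-monotone*, or *sunset* coupling of $\mu$ and $\nu$ if it is the shadow coupling for a source $\hat\mu$ with first marginal $\mu$ that is, respectively, the monotone (increasing) coupling of its two marginals, the antitone (decreasing) coupling of its two marginals, or the product of its two marginals. Define the change of numeraire transformations, for Borel sets $B$, by $$S(\mu)(B)=\frac{\int x\,\mathbf 1_B(1/x)\,\mu(dx)}{\int x\,\mu(dx)},\qquad S(\pi)(B)=\frac{\int x_1\mathbf 1_B(1/x_0,1/x_1)\,\pi(dx)}{\int x_1\,\pi(dx)},\qquad \hat S(\hat\mu)(B)=\frac{\int x\,\mathbf 1_B(1/x,u)\,\hat\mu(dx,du)}{\int x\,\hat\mu(dx,du)}.$$ **Theorem.** If $\pi$ is the shadow coupling between $\mu$ and $\nu$ with source $\hat\mu$, then $\hat S(\hat\mu)$ is a source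 with first marginal $S(\mu)$, and $S(\pi)\in\mathscr M(S(\mu),S(\nu))$ is the shadow coupling between $S(\mu)$ and $S(\nu)$ with source $\hat S(\hat\mu)$. In particular, if $\pi$ is a left-monotone (respectively right-monotone, sunset) coupling of $\mu$ and $\nu$, then $S(\pi)$ is a right-monotone (respectively left-monotone, sunset) coupling of $S(\mu)$ and $S(\nu)$. -/

import Mathlib

open MeasureTheory ProbabilityTheory
open scoped ENNReal

noncomputable section

/-- The open half-line `(0, ∞)`, as a subtype of `ℝ`. -/
abbrev PosReal : Type := {x : ℝ // 0 < x}

instance PosReal.standardBorelSpace : StandardBorelSpace PosReal :=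
  (measurableSet_Ioi : MeasurableSet (Set.Ioi (0 : ℝ))).standardBorel

namespace Shadow

/-- The barycenter (mean) of a measure on `(0, ∞)`. -/
def bary (η : Measure PosReal) : ℝ := ∫ x, (x : ℝ) ∂η

/-- Two-step martingale transport plans with marginals `μ` and `ν`: probabilities `π` on
`(0, ∞)²` with finite first moments, first marginal `μ`, second marginal `ν` and `b(π_x) = x`
for `μ`-almost every `x`, where `(π_x)` is the disintegration along the first coordinate. -/
structure IsMartingalePlan (μ ν : Measure PosReal) (π : Measure (PosReal × PosReal)) :
    Prop where
  prob : IsProbabilityMeasure π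
  integrable_fst : Integrable (fun p => (p.1 : ℝ)) π
  integrable_snd : Integrable (fun p => (p.2 : ℝ)) π
  fst_eq : π.fst = μ
  snd_eq : π.snd = ν
  martingale : ∀ᵐ x ∂π.fst, bary (π.condKernel x) = x

/-- Lifted martingale transport plans: probabilities on triples `((x₀, u), x₁)` with finite first
moments, `(x₀, u)`-marginal `σ`, `x₁`-marginal `ν` and `b(α_{(x₀, u)}) = x₀` almost surely. -/
structure IsLiftedPlan (σ : Measure (PosReal × unitInterval)) (ν : Measure PosReal)
    (α : Measure ((PosReal × unitInterval) × PosReal)) : Prop where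
  prob : IsProbabilityMeasure α
  integrable_zero : Integrable (fun p => (p.1.1 : ℝ)) α
  integrable_one : Integrable (fun p => (p.2 : ℝ)) α
  fst_eq : α.fst = σ
  snd_eq : α.snd = ν
  martingale : ∀ᵐ q ∂α.fst, bary (α.condKernel q) = q.1

/-- Sources: probabilities on `(0, ∞) × [0, 1]` with finite first moment whose second marginal
has no atoms. -/
structure IsSource (σ : Measure (PosReal × unitInterval)) : Prop where
  prob : IsProbabilityMeasure σ
  integrable_fst : Integrable (fun p => (p.1 : ℝ)) σ
  noAtoms : ∀ u : unitInterval, σ.snd {u} = 0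

/-- The weak transport cost `C^σ(η)`: with `m = b(η)`, the infimum of
`∫ (1 - u) √(1 + x₁²) dα` over all lifted martingale plans `α` from `δ_m ⊗ σ_m` to `η`,
where `(σ_x)` is the disintegration of `σ` along its first coordinate. -/
def sourceCost (σ : Measure (PosReal × unitInterval)) [IsFiniteMeasure σ]
    (η : Measure PosReal) : ℝ≥0∞ :=
  ⨅ (m : PosReal) (_ : (m : ℝ) = bary η)
    (α : Measure ((PosReal × unitInterval) × PosReal))
    (_ : IsLiftedPlan ((Measure.dirac m).prod (σ.condKernel m)) η α),
    ∫⁻ p, ENNReal.ofReal ((1 - (p.1.2 : ℝ)) * √(1 + (p.2 : ℝ) ^ 2)) ∂α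

/-- The weak transport functional `π ↦ ∫ C^σ(π_x) μ(dx)`. -/
def planCost (μ : Measure PosReal) (σ : Measure (PosReal × unitInterval)) [IsFiniteMeasure σ]
    (π : Measure (PosReal × PosReal)) [IsFiniteMeasure π] : ℝ≥0∞ :=
  ∫⁻ x, sourceCost σ (π.condKernel x) ∂μ

/-- The value `V^σ` of the weak martingale transport problem between `μ` and `ν`. -/
def shadowValue (μ ν : Measure PosReal) (σ : Measure (PosReal × unitInterval))
    [IsFiniteMeasure σ] : ℝ≥0∞ :=
  ⨅ (π : Measure (PosReal × PosReal)) (_ : IsProbabilityMeasure π)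
    (_ : IsMartingalePlan μ ν π), planCost μ σ π

/-- `π` is the shadow coupling between `μ` and `ν` with source `σ`: `σ` is a source with first
marginal `μ`, and `π` is the unique optimizer of the weak martingale transport problem. -/
structure IsShadowCoupling (μ ν : Measure PosReal) (σ : Measure (PosReal × unitInterval))
    (π : Measure (PosReal × PosReal)) : Prop where
  source_prob : IsProbabilityMeasure σ
  plan_prob : IsProbabilityMeasure π
  source : IsSource σ
  source_fst : σ.fst = μ
  plan : IsMartingalePlan μ ν π
  optimal : planCost μ σ π = shadowValue μ ν σ
  unique : ∀ (π' : Measure (PosReal × PosReal)) [IsProbabilityMeasure π'],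
    IsMartingalePlan μ ν π' → planCost μ σ π' = shadowValue μ ν σ → π' = π

/-- The source is the monotone coupling of its marginals (it is concentrated on a monotone set). -/
def IsMonotoneSource (σ : Measure (PosReal × unitInterval)) : Prop :=
  ∃ Γ : Set (PosReal × unitInterval), σ Γᶜ = 0 ∧ MonovaryOn Prod.fst Prod.snd Γ

/-- The source is the antitone coupling of its marginals (it is concentrated on an antitone
set). -/
def IsAntitoneSource (σ : Measure (PosReal × unitInterval)) : Prop :=
  ∃ Γ : Set (PosReal × unitInterval), σ Γᶜ = 0 ∧ AntivaryOn Prod.fst Prod.snd Γ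

/-- The left-monotone martingale coupling: the shadow coupling whose source is the monotone
coupling of its marginals. -/
def IsLeftMonotone (μ ν : Measure PosReal) (π : Measure (PosReal × PosReal)) : Prop :=
  ∃ σ, IsMonotoneSource σ ∧ IsShadowCoupling μ ν σ π

/-- The right-monotone martingale coupling: the shadow coupling whose source is the antitone
coupling of its marginals. -/
def IsRightMonotone (μ ν : Measure PosReal) (π : Measure (PosReal × PosReal)) : Prop :=
  ∃ σ, IsAntitoneSource σ ∧ IsShadowCoupling μ ν σ π

/-- The sunset coupling: the shadow coupling whose source is the product of its marginals. -/
def IsSunset (μ ν : Measure PosReal) (π : Measure (PosReal × PosReal)) : Prop :=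
  ∃ σ, σ = σ.fst.prod σ.snd ∧ IsShadowCoupling μ ν σ π

/-- Change of numeraire: the law of `T` under the measure with normalized density
`D / ∫ D dρ` with respect to `ρ`. -/
def changeNumeraire {Ω : Type*} [MeasurableSpace Ω] (D : Ω → PosReal) (T : Ω → Ω)
    (ρ : Measure Ω) : Measure Ω :=
  (∫⁻ ω, ENNReal.ofReal (D ω) ∂ρ)⁻¹ •
    (ρ.withDensity fun ω => ENNReal.ofReal (D ω)).map T

/-- `S` on measures on `(0, ∞)`. -/
def cnMarginal (μ : Measure PosReal) : Measure PosReal :=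
  changeNumeraire (fun x => x) (fun x => x⁻¹) μ

/-- `S` on measures on `(0, ∞)²`, with the terminal value `x₁` as numeraire. -/
def cnPlan (π : Measure (PosReal × PosReal)) : Measure (PosReal × PosReal) :=
  changeNumeraire (fun p => p.2) (fun p => (p.1⁻¹, p.2⁻¹)) π

/-- The extended transformation `Ŝ` on measures on `(0, ∞) × [0, 1]`. -/
def cnSource (σ : Measure (PosReal × unitInterval)) : Measure (PosReal × unitInterval) :=
  changeNumeraire (fun p => p.1) (fun p => (p.1⁻¹, p.2)) σ

end Shadow

end

/-! The cost is invariant under the change of numeraire: `y * √(1 + y⁻²) = √(1 + y²)`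
(`ofReal_mul_cost_inv`), while `u` is untouched. Reweighting a martingale plan by `x₁` and inverting
the coordinates is an involution that maps plans between `μ` and `ν` onto plans between `S(μ)` and
`S(ν)` (`IsPlan.cnJoint`), because conditionally on `x₀` the weight `x₁` has mean `x₀`. The same
argument for lifted plans shows that `C` at `S(η)` for the transformed source is `C(η) / m`, with `m
= b(η)` (`ofReal_mul_sourceCost`).

Disintegrations transform as `S(π)_{1/x} = S(π_x)` and `Ŝ(σ)_{1/x} = σ_x` (`ae_condKernel_cnPlan`,
`ae_condKernel_cnSource`). Integrating against `S(μ)`, the weight `x` cancels `1 / m`, since `b(π_x)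
= x`. Plan costs are thus all scaled by one constant, the inverse mean of `μ` (`planCost_cnPlan`),
and minimizers correspond, with uniqueness. Inversion reverses order, so monotone and antitone
sources are exchanged, and products stay products. -/

namespace Shadow

/-! ### Positive reals and barycenters as lower Lebesgue integrals -/

section PosReal

lemma ofReal_coe_inv (x : PosReal) :
    ENNReal.ofReal ((x⁻¹ : PosReal) : ℝ) = (ENNReal.ofReal x)⁻¹ :=
  ENNReal.ofReal_inv_of_pos x.2

lemma ofReal_coe_ne_zero (x : PosReal) : ENNReal.ofReal (x : ℝ) ≠ 0 :=
  (ENNReal.ofReal_pos.2 x.2).ne'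

lemma mul_ofReal_coe_inv (x : PosReal) :
    ENNReal.ofReal (x : ℝ) * ENNReal.ofReal ((x⁻¹ : PosReal) : ℝ) = 1 := by
  rw [ofReal_coe_inv]
  exact ENNReal.mul_inv_cancel (ofReal_coe_ne_zero x) ENNReal.ofReal_ne_top

lemma measurable_ofReal_coe : Measurable fun x : PosReal => ENNReal.ofReal (x : ℝ) :=
  measurable_subtype_coe.ennreal_ofReal

lemma _root_.Measurable.ofReal_coe {Ω : Type*} [MeasurableSpace Ω] {D : Ω → PosReal}
    (hD : Measurable D) : Measurable fun ω => ENNReal.ofReal (D ω : ℝ) :=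
  measurable_ofReal_coe.comp hD

lemma measurable_posReal_inv : Measurable fun x : PosReal => x⁻¹ :=
  (measurable_subtype_coe.inv).subtype_mk

lemma integrable_coe_iff {Ω : Type*} [MeasurableSpace Ω] {ρ : Measure Ω} {D : Ω → PosReal}
    (hD : Measurable D) :
    Integrable (fun ω => (D ω : ℝ)) ρ ↔ ∫⁻ ω, ENNReal.ofReal (D ω) ∂ρ ≠ ∞ := by
  have hm : AEStronglyMeasurable (fun ω => (D ω : ℝ)) ρ :=
    (measurable_subtype_coe.comp hD).aestronglyMeasurable
  rw [← lt_top_iff_ne_top,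
    ← hasFiniteIntegral_iff_ofReal (Filter.Eventually.of_forall fun ω => (D ω).2.le)]
  exact ⟨fun h => h.2, fun h => ⟨hm, h⟩⟩

lemma bary_eq_iff (η : Measure PosReal) (m : PosReal) :
    bary η = m ↔ ∫⁻ x, ENNReal.ofReal (x : ℝ) ∂η = ENNReal.ofReal m := by
  have h : bary η = (∫⁻ x, ENNReal.ofReal (x : ℝ) ∂η).toReal :=
    integral_eq_lintegral_of_nonneg_ae (Filter.Eventually.of_forall fun x => x.2.le)
      measurable_subtype_coe.aestronglyMeasurable
  rw [h]
  constructor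
  · intro h'
    rw [← h', ENNReal.ofReal_toReal]
    -- A divergent integral would give barycenter `0`, which positivity of `m` excludes.
    intro htop
    rw [htop, ENNReal.toReal_top] at h'
    exact m.2.ne h'
  · intro h'
    rw [h', ENNReal.toReal_ofReal m.2.le]

end PosReal

/-! ### The abstract change of numeraire -/

section ChangeNumeraire

variable {Ω : Type*} [MeasurableSpace Ω] {D : Ω → PosReal} {T : Ω → Ω} {ρ : Measure Ω}

/-- No measurability of `f` is needed, since `T` is a measurable equivalence and the density is
finite. This matters when `f` is built from `sourceCost`, whose measurability is never established.
-/
lemma lintegral_changeNumeraire (hD : Measurable D) (hT : Measurable T)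
    (hTT : Function.Involutive T) (ρ : Measure Ω) (f : Ω → ℝ≥0∞) :
    ∫⁻ ω, f ω ∂(changeNumeraire D T ρ) =
      (∫⁻ ω, ENNReal.ofReal (D ω) ∂ρ)⁻¹ * ∫⁻ ω, ENNReal.ofReal (D ω) * f (T ω) ∂ρ := by
  have h := lintegral_map_equiv (μ := ρ.withDensity fun ω => ENNReal.ofReal (D ω)) f
    (MeasurableEquiv.ofInvolutive T hTT hT)
  simp only [MeasurableEquiv.ofInvolutive_apply] at h
  rw [changeNumeraire, lintegral_smul_measure, smul_eq_mul]
  congr 1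
  refine h.trans ?_
  rw [lintegral_withDensity_eq_lintegral_mul_non_measurable _ (hD.ofReal_coe)
    (Filter.Eventually.of_forall fun _ => ENNReal.ofReal_lt_top)]
  rfl

/-- The density is strictly positive and the normalizing factor nonzero, so null sets are only moved
by `T`. -/
lemma ae_changeNumeraire_iff (hD : Measurable D) (hT : Measurable T)
    (hTT : Function.Involutive T) (hρ : ∫⁻ ω, ENNReal.ofReal (D ω) ∂ρ ≠ ∞) {P : Ω → Prop} :
    (∀ᵐ ω ∂(changeNumeraire D T ρ), P ω) ↔ ∀ᵐ ω ∂ρ, P (T ω) := by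
  rw [changeNumeraire, Measure.ae_ennreal_smul_measure_iff (ENNReal.inv_ne_zero.2 hρ)]
  refine (MeasurableEquiv.ofInvolutive T hTT hT).measurableEmbedding.ae_map_iff.trans ?_
  rw [ae_withDensity_iff (hD.ofReal_coe)]
  exact Filter.eventually_congr (Filter.Eventually.of_forall fun ω =>
    ⟨fun h => h (ofReal_coe_ne_zero _), fun h _ => h⟩)

lemma lintegral_coe_ne_zero (hD : Measurable D) [NeZero ρ] :
    ∫⁻ ω, ENNReal.ofReal (D ω) ∂ρ ≠ 0 := by
  rw [Ne, lintegral_eq_zero_iff (hD.ofReal_coe)]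
  intro h
  have : ∀ᵐ ω ∂ρ, False := h.mono fun ω hω => ofReal_coe_ne_zero _ hω
  simp [NeZero.ne ρ] at this

lemma isProbabilityMeasure_changeNumeraire (hD : Measurable D) (hT : Measurable T)
    (hTT : Function.Involutive T) [IsProbabilityMeasure ρ]
    (hρ : ∫⁻ ω, ENNReal.ofReal (D ω) ∂ρ ≠ ∞) :
    IsProbabilityMeasure (changeNumeraire D T ρ) := by
  constructor
  rw [← lintegral_one, lintegral_changeNumeraire hD hT hTT]
  simp only [mul_one]
  exact ENNReal.inv_mul_cancel (lintegral_coe_ne_zero hD) hρ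

lemma lintegral_coe_changeNumeraire (hD : Measurable D) (hT : Measurable T)
    (hTT : Function.Involutive T) (hDT : ∀ ω, D (T ω) = (D ω)⁻¹) [IsProbabilityMeasure ρ] :
    ∫⁻ ω, ENNReal.ofReal (D ω) ∂(changeNumeraire D T ρ) =
      (∫⁻ ω, ENNReal.ofReal (D ω) ∂ρ)⁻¹ := by
  rw [lintegral_changeNumeraire hD hT hTT]
  simp [hDT, mul_ofReal_coe_inv, -Positive.coe_inv]

/-- The densities cancel pointwise by `hDT`, and the two normalizing constants are mutually inverse.
-/
lemma changeNumeraire_changeNumeraire (hD : Measurable D) (hT : Measurable T)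
    (hTT : Function.Involutive T) (hDT : ∀ ω, D (T ω) = (D ω)⁻¹) [IsProbabilityMeasure ρ]
    (hρ : ∫⁻ ω, ENNReal.ofReal (D ω) ∂ρ ≠ ∞) :
    changeNumeraire D T (changeNumeraire D T ρ) = ρ := by
  refine Measure.ext_of_lintegral _ fun f _ => ?_
  rw [lintegral_changeNumeraire hD hT hTT, lintegral_coe_changeNumeraire hD hT hTT hDT,
    lintegral_changeNumeraire hD hT hTT, ← mul_assoc, inv_inv,
    ENNReal.mul_inv_cancel (lintegral_coe_ne_zero hD) hρ, one_mul]
  refine lintegral_congr fun ω => ?_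
  rw [hDT, hTT, ← mul_assoc, mul_ofReal_coe_inv, one_mul]

end ChangeNumeraire

/-! ### Martingale plans and their change of numeraire -/

section Plan

variable {Ω : Type*} [MeasurableSpace Ω]

/-- Couplings `α` of `σ` and `ν` for which the second coordinate has conditional expectation
`X q` given the first coordinate `q`; the martingale condition is stated with test functions. -/
structure IsPlan (X : Ω → PosReal) (σ : Measure Ω) (ν : Measure PosReal)
    (α : Measure (Ω × PosReal)) : Prop where
  prob : IsProbabilityMeasure α
  lintegral_snd : ∫⁻ p, ENNReal.ofReal (p.2 : ℝ) ∂α ≠ ∞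
  fst_eq : α.fst = σ
  snd_eq : α.snd = ν
  martingale : ∀ f : Ω → ℝ≥0∞, Measurable f →
    ∫⁻ p, f p.1 * ENNReal.ofReal (p.2 : ℝ) ∂α = ∫⁻ p, f p.1 * ENNReal.ofReal (X p.1) ∂α

/-- Removes the disintegration from the martingale condition, so that it can be transported by
computing integrals. Indicators as test functions recover the almost sure statement. -/
lemma ae_bary_condKernel_iff {X : Ω → PosReal} (hX : Measurable X) (α : Measure (Ω × PosReal))
    [IsFiniteMeasure α] :
    (∀ᵐ q ∂α.fst, bary (α.condKernel q) = X q) ↔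
      ∀ f : Ω → ℝ≥0∞, Measurable f →
        ∫⁻ p, f p.1 * ENNReal.ofReal (p.2 : ℝ) ∂α =
          ∫⁻ p, f p.1 * ENNReal.ofReal (X p.1) ∂α := by
  simp only [bary_eq_iff]
  have hXm := hX.ofReal_coe
  have h1 : ∀ f : Ω → ℝ≥0∞, Measurable f → ∫⁻ p, f p.1 * ENNReal.ofReal (p.2 : ℝ) ∂α =
      ∫⁻ q, f q * ∫⁻ x, ENNReal.ofReal (x : ℝ) ∂(α.condKernel q) ∂α.fst := by
    intro f hf
    rw [← Measure.lintegral_condKernel (f := fun p : Ω × PosReal => f p.1 * ENNReal.ofReal (p.2 : ℝ))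
      ((hf.comp measurable_fst).mul measurable_snd.ofReal_coe)]
    exact lintegral_congr fun q => lintegral_const_mul (f q) measurable_ofReal_coe
  have h2 : ∀ f : Ω → ℝ≥0∞, Measurable f → ∫⁻ p, f p.1 * ENNReal.ofReal (X p.1) ∂α =
      ∫⁻ q, f q * ENNReal.ofReal (X q) ∂α.fst := by
    intro f hf
    exact (lintegral_map (hf.mul hXm) measurable_fst).symm
  constructor
  · intro h f hf
    rw [h1 f hf, h2 f hf]
    exact lintegral_congr_ae (h.mono fun q hq => by simp only [hq])
  · intro h
    refine ae_eq_of_forall_setLIntegral_eq_of_sigmaFinite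
      (measurable_ofReal_coe.lintegral_kernel) hXm fun s hs _ => ?_
    have h3 := h (s.indicator 1) (measurable_one.indicator hs)
    rw [h1 _ (measurable_one.indicator hs), h2 _ (measurable_one.indicator hs)] at h3
    rw [← lintegral_indicator hs, ← lintegral_indicator hs]
    convert h3 using 3 with q q <;> by_cases hq : q ∈ s <;> simp [hq]

lemma IsPlan.lintegral_fst_ne_top {X : Ω → PosReal} {σ : Measure Ω}
    {ν : Measure PosReal} {α : Measure (Ω × PosReal)} (h : IsPlan X σ ν α) :
    ∫⁻ p, ENNReal.ofReal (X p.1) ∂α ≠ ∞ := by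
  have := h.martingale 1 measurable_one
  simp only [Pi.one_apply, one_mul] at this
  exact this ▸ h.lintegral_snd

lemma IsPlan.lintegral_source {X : Ω → PosReal} (hX : Measurable X) {σ : Measure Ω}
    {ν : Measure PosReal} {α : Measure (Ω × PosReal)} (h : IsPlan X σ ν α) :
    ∫⁻ q, ENNReal.ofReal (X q) ∂σ = ∫⁻ p, ENNReal.ofReal (p.2 : ℝ) ∂α := by
  have := h.martingale 1 measurable_one
  simp only [Pi.one_apply, one_mul] at this
  rw [this, ← h.fst_eq]
  exact lintegral_map (hX.ofReal_coe) measurable_fst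

lemma IsPlan.lintegral_target {X : Ω → PosReal} {σ : Measure Ω}
    {ν : Measure PosReal} {α : Measure (Ω × PosReal)} (h : IsPlan X σ ν α) :
    ∫⁻ x, ENNReal.ofReal (x : ℝ) ∂ν = ∫⁻ p, ENNReal.ofReal (p.2 : ℝ) ∂α := by
  rw [← h.snd_eq]
  exact lintegral_map measurable_ofReal_coe measurable_snd

/-- The change of numeraire on plans, with the second coordinate as numeraire. -/
noncomputable def cnJoint (T : Ω → Ω) (α : Measure (Ω × PosReal)) : Measure (Ω × PosReal) :=
  changeNumeraire (fun p => p.2) (fun p => (T p.1, p.2⁻¹)) α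

variable {T : Ω → Ω}

lemma measurable_prodMap_inv (hT : Measurable T) :
    Measurable fun p : Ω × PosReal => (T p.1, p.2⁻¹) :=
  (hT.comp measurable_fst).prodMk (measurable_posReal_inv.comp measurable_snd)

lemma involutive_prodMap_inv {Ω : Type*} {T : Ω → Ω} (hTT : Function.Involutive T) :
    Function.Involutive fun p : Ω × PosReal => (T p.1, p.2⁻¹) :=
  fun p => by simp [hTT p.1]

lemma lintegral_cnJoint (hT : Measurable T) (hTT : Function.Involutive T)
    (α : Measure (Ω × PosReal)) (f : Ω × PosReal → ℝ≥0∞) :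
    ∫⁻ p, f p ∂(cnJoint T α) = (∫⁻ p, ENNReal.ofReal (p.2 : ℝ) ∂α)⁻¹ *
      ∫⁻ p, ENNReal.ofReal (p.2 : ℝ) * f (T p.1, p.2⁻¹) ∂α :=
  lintegral_changeNumeraire measurable_snd (measurable_prodMap_inv hT)
    (involutive_prodMap_inv hTT) α f

lemma cnJoint_cnJoint (hT : Measurable T) (hTT : Function.Involutive T)
    {α : Measure (Ω × PosReal)} [IsProbabilityMeasure α]
    (hα : ∫⁻ p, ENNReal.ofReal (p.2 : ℝ) ∂α ≠ ∞) : cnJoint T (cnJoint T α) = α :=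
  changeNumeraire_changeNumeraire measurable_snd (measurable_prodMap_inv hT)
    (involutive_prodMap_inv hTT) (fun _ => rfl) hα

lemma lintegral_cnMarginal (η : Measure PosReal) (f : PosReal → ℝ≥0∞) :
    ∫⁻ x, f x ∂(cnMarginal η) = (∫⁻ x, ENNReal.ofReal (x : ℝ) ∂η)⁻¹ *
      ∫⁻ x, ENNReal.ofReal (x : ℝ) * f x⁻¹ ∂η :=
  lintegral_changeNumeraire measurable_id measurable_posReal_inv inv_involutive η f

lemma cnMarginal_cnMarginal {η : Measure PosReal} [IsProbabilityMeasure η]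
    (hη : ∫⁻ x, ENNReal.ofReal (x : ℝ) ∂η ≠ ∞) : cnMarginal (cnMarginal η) = η :=
  changeNumeraire_changeNumeraire measurable_id measurable_posReal_inv inv_involutive
    (fun _ => rfl) hη

lemma lintegral_coe_cnMarginal (η : Measure PosReal) [IsProbabilityMeasure η] :
    ∫⁻ x, ENNReal.ofReal (x : ℝ) ∂(cnMarginal η) = (∫⁻ x, ENNReal.ofReal (x : ℝ) ∂η)⁻¹ :=
  lintegral_coe_changeNumeraire measurable_id measurable_posReal_inv inv_involutive fun _ => rfl

lemma ae_cnMarginal_iff {η : Measure PosReal}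
    (hη : ∫⁻ x, ENNReal.ofReal (x : ℝ) ∂η ≠ ∞) {P : PosReal → Prop} :
    (∀ᵐ x ∂(cnMarginal η), P x) ↔ ∀ᵐ x ∂η, P x⁻¹ :=
  ae_changeNumeraire_iff measurable_id measurable_posReal_inv inv_involutive hη

/-- On functions of `q` alone the weight `x₁` acts as `X q`, by the martingale property; hence the
first marginal changes with numeraire `X`. Stated for general `X` to cover two-step and lifted plans
at once. -/
lemma IsPlan.cnJoint {X : Ω → PosReal} (hX : Measurable X) (hT : Measurable T)
    (hTT : Function.Involutive T) (hXT : ∀ q, X (T q) = (X q)⁻¹) {σ : Measure Ω}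
    {ν : Measure PosReal} {α : Measure (Ω × PosReal)} (h : IsPlan X σ ν α) :
    IsPlan X (changeNumeraire X T σ) (cnMarginal ν) (cnJoint T α) where
  prob := by
    have := h.prob
    exact isProbabilityMeasure_changeNumeraire measurable_snd (measurable_prodMap_inv hT)
      (involutive_prodMap_inv hTT) h.lintegral_snd
  lintegral_snd := by
    have := h.prob
    rw [Shadow.cnJoint, lintegral_coe_changeNumeraire measurable_snd (measurable_prodMap_inv hT)
      (involutive_prodMap_inv hTT) (fun _ => rfl)]
    exact ENNReal.inv_ne_top.2 (lintegral_coe_ne_zero measurable_snd)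
  fst_eq := by
    refine Measure.ext_of_lintegral _ fun f hf => ?_
    rw [Measure.fst, lintegral_map hf measurable_fst, lintegral_cnJoint hT hTT,
      lintegral_changeNumeraire hX hT hTT, h.lintegral_source hX, ← h.fst_eq, Measure.fst,
      lintegral_map (by exact (hX.ofReal_coe).mul (hf.comp hT)) measurable_fst]
    simp_rw [mul_comm _ (f _)]
    rw [h.martingale (fun q => f (T q)) (hf.comp hT)]
  snd_eq := by
    refine Measure.ext_of_lintegral _ fun f hf => ?_
    rw [Measure.snd, lintegral_map hf measurable_snd, lintegral_cnJoint hT hTT,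
      lintegral_cnMarginal, h.lintegral_target, ← h.snd_eq, Measure.snd,
      lintegral_map (by exact measurable_ofReal_coe.mul (hf.comp measurable_posReal_inv))
        measurable_snd]
  martingale := by
    intro f hf
    rw [lintegral_cnJoint hT hTT, lintegral_cnJoint hT hTT]
    congr 1
    -- The factor `(X q)⁻¹` makes both sides of the new martingale identity equal to `∫ f (T q) dα`:
    -- on one side `x₁` cancels its own inverse, on the other `X q` does.
    have h1 := h.martingale (fun q => f (T q) * ENNReal.ofReal ((X q)⁻¹ : PosReal))
      ((hf.comp hT).mul (measurable_ofReal_coe.comp (measurable_posReal_inv.comp hX)))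
    calc _ = ∫⁻ p, f (T p.1) ∂α := lintegral_congr fun p => by
            rw [mul_left_comm, mul_ofReal_coe_inv, mul_one]
      _ = ∫⁻ p, f (T p.1) * ENNReal.ofReal ((X p.1)⁻¹ : PosReal) * ENNReal.ofReal (X p.1) ∂α :=
          lintegral_congr fun p => by
            rw [mul_assoc, mul_comm (ENNReal.ofReal _), mul_ofReal_coe_inv, mul_one]
      _ = _ := by
          rw [← h1]
          exact lintegral_congr fun p => by simp only [hXT]; rw [mul_comm]

end Plan

/-- Integrability of the first coordinate is automatic: testing the martingale condition with `1`
equates the two means. -/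
lemma isMartingalePlan_iff {μ ν : Measure PosReal} {π : Measure (PosReal × PosReal)} :
    IsMartingalePlan μ ν π ↔ IsPlan id μ ν π := by
  constructor
  · intro h
    have := h.prob
    exact ⟨h.prob, (integrable_coe_iff measurable_snd).1 h.integrable_snd, h.fst_eq, h.snd_eq,
      (ae_bary_condKernel_iff measurable_id π).1 h.martingale⟩
  · intro h
    have := h.prob
    refine ⟨h.prob, (integrable_coe_iff measurable_fst).2 ?_,
      (integrable_coe_iff measurable_snd).2 h.lintegral_snd, h.fst_eq, h.snd_eq,
      (ae_bary_condKernel_iff measurable_id π).2 h.martingale⟩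
    exact h.lintegral_fst_ne_top

lemma isLiftedPlan_iff {σ : Measure (PosReal × unitInterval)} {ν : Measure PosReal}
    {α : Measure ((PosReal × unitInterval) × PosReal)} :
    IsLiftedPlan σ ν α ↔ IsPlan Prod.fst σ ν α := by
  constructor
  · intro h
    have := h.prob
    exact ⟨h.prob, (integrable_coe_iff measurable_snd).1 h.integrable_one, h.fst_eq, h.snd_eq,
      (ae_bary_condKernel_iff measurable_fst α).1 h.martingale⟩
  · intro h
    have := h.prob
    refine ⟨h.prob, (integrable_coe_iff (measurable_fst.comp measurable_fst)).2 ?_,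
      (integrable_coe_iff measurable_snd).2 h.lintegral_snd, h.fst_eq, h.snd_eq,
      (ae_bary_condKernel_iff measurable_fst α).2 h.martingale⟩
    exact h.lintegral_fst_ne_top

end Shadow

namespace Shadow

/-! ### Transformation of sources and of the weak transport cost -/

section SourceCost

lemma measurable_inv_fst : Measurable fun q : PosReal × unitInterval => (q.1⁻¹, q.2) :=
  (measurable_posReal_inv.comp measurable_fst).prodMk measurable_snd

lemma involutive_inv_fst :
    Function.Involutive fun q : PosReal × unitInterval => (q.1⁻¹, q.2) :=
  fun q => by simp

lemma lintegral_cnSource (σ : Measure (PosReal × unitInterval))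
    (f : PosReal × unitInterval → ℝ≥0∞) :
    ∫⁻ q, f q ∂(cnSource σ) = (∫⁻ q, ENNReal.ofReal (q.1 : ℝ) ∂σ)⁻¹ *
      ∫⁻ q, ENNReal.ofReal (q.1 : ℝ) * f (q.1⁻¹, q.2) ∂σ :=
  lintegral_changeNumeraire measurable_fst measurable_inv_fst involutive_inv_fst σ f

lemma fst_cnSource (σ : Measure (PosReal × unitInterval)) :
    (cnSource σ).fst = cnMarginal σ.fst := by
  refine Measure.ext_of_lintegral _ fun f hf => ?_
  rw [lintegral_cnMarginal, Measure.fst, Measure.fst, lintegral_map hf measurable_fst,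
    lintegral_cnSource, lintegral_map measurable_ofReal_coe measurable_fst, lintegral_map (by
      exact measurable_ofReal_coe.mul (hf.comp measurable_posReal_inv)) measurable_fst]

/-- Serves both the sunset case and the sources `δ_m ⊗ σ_m` inside `sourceCost`. -/
lemma cnSource_prod (μ : Measure PosReal) (κ : Measure unitInterval) [SFinite μ]
    [IsProbabilityMeasure κ] [SFinite (cnMarginal μ)] :
    cnSource (μ.prod κ) = (cnMarginal μ).prod κ := by
  refine Measure.ext_of_lintegral _ fun f hf => ?_
  have h1 : ∫⁻ q, ENNReal.ofReal (q.1 : ℝ) ∂(μ.prod κ) = ∫⁻ x, ENNReal.ofReal (x : ℝ) ∂μ := by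
    rw [lintegral_prod _ measurable_fst.ofReal_coe.aemeasurable]
    simp
  rw [lintegral_cnSource, h1, lintegral_prod _ hf.aemeasurable, lintegral_cnMarginal,
    lintegral_prod _ (by
      exact (measurable_fst.ofReal_coe.mul (hf.comp measurable_inv_fst)).aemeasurable)]
  congr 1
  refine lintegral_congr fun x => ?_
  dsimp only
  exact lintegral_const_mul (f := fun u => f (x⁻¹, u)) _ (hf.comp measurable_prodMk_left)

lemma cnMarginal_dirac (m : PosReal) : cnMarginal (Measure.dirac m) = Measure.dirac m⁻¹ := by
  refine Measure.ext_of_lintegral _ fun f hf => ?_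
  rw [lintegral_cnMarginal, lintegral_dirac, lintegral_dirac, lintegral_dirac, ← mul_assoc,
    ENNReal.inv_mul_cancel (ofReal_coe_ne_zero m) ENNReal.ofReal_ne_top, one_mul]

lemma ofReal_mul_cost_inv (u : unitInterval) (y : PosReal) :
    ENNReal.ofReal (y : ℝ) *
        ENNReal.ofReal ((1 - (u : ℝ)) * √(1 + ((y⁻¹ : PosReal) : ℝ) ^ 2)) =
      ENNReal.ofReal ((1 - (u : ℝ)) * √(1 + (y : ℝ) ^ 2)) := by
  rw [← ENNReal.ofReal_mul y.2.le, Positive.coe_inv, mul_left_comm]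
  congr 2
  have hy := y.2
  rw [← Real.sqrt_sq hy.le, ← Real.sqrt_mul (sq_nonneg _), Real.sqrt_sq hy.le]
  congr 1
  field_simp
  ring

/-- Each competitor for `η` is sent by `cnJoint` to a competitor for `cnMarginal η`. The sources
enter only through one fibre each, so assuming `hσ` for arbitrary `σ'` keeps the statement symmetric
and lets it be applied backwards. -/
lemma ofReal_mul_sourceCost_le {σ σ' : Measure (PosReal × unitInterval)} [IsFiniteMeasure σ]
    [IsFiniteMeasure σ'] {η : Measure PosReal} {m : PosReal}
    (hη : ∫⁻ x, ENNReal.ofReal (x : ℝ) ∂η = ENNReal.ofReal m)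
    (hσ : σ'.condKernel m⁻¹ = σ.condKernel m) :
    ENNReal.ofReal m * sourceCost σ' (cnMarginal η) ≤ sourceCost σ η := by
  refine le_iInf fun m' => le_iInf fun hm' => le_iInf fun α => le_iInf fun hα => ?_
  obtain rfl : m' = m := Subtype.ext (hm'.trans ((bary_eq_iff η m).2 hη))
  have hα' := isLiftedPlan_iff.1 hα
  have := hα'.prob
  have hη' : IsProbabilityMeasure η := hα'.snd_eq ▸ inferInstance
  have hα'' : IsPlan Prod.fst (cnSource _) _ _ :=
    hα'.cnJoint measurable_fst measurable_inv_fst involutive_inv_fst fun _ => rfl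
  have hd := cnMarginal_dirac m'
  have : SFinite (cnMarginal (Measure.dirac m')) := hd ▸ inferInstance
  have hs := cnSource_prod (Measure.dirac m') (σ.condKernel m')
  rw [hs, hd, ← hσ] at hα''
  have hb : ((m'⁻¹ : PosReal) : ℝ) = bary (cnMarginal η) := by
    refine ((bary_eq_iff _ _).2 ?_).symm
    rw [lintegral_coe_cnMarginal, hη, ofReal_coe_inv]
  have hle : sourceCost σ' (cnMarginal η) ≤ _ :=
    iInf_le_of_le m'⁻¹ <| iInf_le_of_le hb <| iInf_le_of_le _ <|
      iInf_le _ (isLiftedPlan_iff.2 hα'')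
  refine (mul_le_mul_right hle _).trans_eq ?_
  rw [lintegral_cnJoint measurable_inv_fst involutive_inv_fst, ← hα'.lintegral_target, hη,
    ← mul_assoc, ENNReal.mul_inv_cancel (ofReal_coe_ne_zero m') ENNReal.ofReal_ne_top, one_mul]
  exact lintegral_congr fun p => ofReal_mul_cost_inv _ _

lemma ofReal_mul_sourceCost {σ σ' : Measure (PosReal × unitInterval)} [IsFiniteMeasure σ]
    [IsFiniteMeasure σ'] {η : Measure PosReal} [IsProbabilityMeasure η] {m : PosReal}
    (hη : ∫⁻ x, ENNReal.ofReal (x : ℝ) ∂η = ENNReal.ofReal m)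
    (hσ : σ'.condKernel m⁻¹ = σ.condKernel m) :
    ENNReal.ofReal m * sourceCost σ' (cnMarginal η) = sourceCost σ η := by
  refine le_antisymm (ofReal_mul_sourceCost_le hη hσ) ?_
  -- The reverse inequality is the same one for the transformed data, by involutivity.
  have h := ofReal_mul_sourceCost_le (σ := σ') (σ' := σ) (η := cnMarginal η) (m := m⁻¹) (by
    rw [lintegral_coe_cnMarginal, hη, ofReal_coe_inv]) (by rw [inv_inv, hσ])
  rw [cnMarginal_cnMarginal (hη ▸ ENNReal.ofReal_ne_top)] at h
  calc sourceCost σ η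
      = ENNReal.ofReal m * (ENNReal.ofReal (m⁻¹ : PosReal) * sourceCost σ η) := by
        rw [← mul_assoc, mul_ofReal_coe_inv, one_mul]
    _ ≤ _ := mul_le_mul_right h _

end SourceCost

/-! ### Disintegrations of transformed sources and plans -/

section CondKernel

/-- The weight is constant on each fibre over `x`, so it only affects the first marginal; uniqueness
of disintegration concludes. -/
lemma ae_condKernel_cnSource {σ : Measure (PosReal × unitInterval)} [IsProbabilityMeasure σ]
    [IsFiniteMeasure (cnSource σ)] (hσ : ∫⁻ q, ENNReal.ofReal (q.1 : ℝ) ∂σ ≠ ∞) :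
    ∀ᵐ x ∂σ.fst, (cnSource σ).condKernel x⁻¹ = σ.condKernel x := by
  have hM : ∫⁻ x, ENNReal.ofReal (x : ℝ) ∂σ.fst = ∫⁻ q, ENNReal.ofReal (q.1 : ℝ) ∂σ :=
    lintegral_map measurable_ofReal_coe measurable_fst
  have hfst := fst_cnSource σ
  have : IsFiniteMeasure (cnMarginal σ.fst) := hfst ▸ inferInstance
  have h := eq_condKernel_of_measure_eq_compProd (ρ := cnSource σ)
    (σ.condKernel.comap _ measurable_posReal_inv) (by
      refine Measure.ext_of_lintegral _ fun f hf => ?_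
      have hf' : Measurable fun q : PosReal × unitInterval =>
          ENNReal.ofReal (q.1 : ℝ) * f (q.1⁻¹, q.2) :=
        measurable_fst.ofReal_coe.mul (hf.comp measurable_inv_fst)
      rw [Measure.lintegral_compProd hf, hfst, lintegral_cnSource, lintegral_cnMarginal, hM,
        ← Measure.lintegral_condKernel hf']
      congr 1
      refine lintegral_congr fun x => ?_
      simp only [Kernel.comap_apply, inv_inv]
      exact lintegral_const_mul (f := fun u => f (x⁻¹, u)) _ (hf.comp measurable_prodMk_left))
  rw [hfst, ae_cnMarginal_iff (hM ▸ hσ)] at h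
  filter_upwards [h] with x hx
  rw [← hx, Kernel.comap_apply, inv_inv]

/-- The change of numeraire, applied to the measures of a Markov kernel on `(0, ∞)`. -/
noncomputable def cnKernel (κ : Kernel PosReal PosReal) : Kernel PosReal PosReal where
  toFun y := cnMarginal (κ y⁻¹)
  measurable' := by
    refine Measure.measurable_of_measurable_coe _ fun B hB => ?_
    have h : ∀ y, cnMarginal (κ y⁻¹) B = (∫⁻ x, ENNReal.ofReal (x : ℝ) ∂(κ y⁻¹))⁻¹ *
        ∫⁻ x, ENNReal.ofReal (x : ℝ) * B.indicator 1 x⁻¹ ∂(κ y⁻¹) := fun y => by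
      rw [← lintegral_cnMarginal, lintegral_indicator_one hB]
    simp only [h]
    have hf : Measurable fun x : PosReal => ENNReal.ofReal (x : ℝ) * B.indicator 1 x⁻¹ :=
      measurable_ofReal_coe.mul ((measurable_one.indicator hB).comp measurable_posReal_inv)
    exact ((measurable_ofReal_coe.lintegral_kernel (κ := κ)).comp measurable_posReal_inv).inv.mul
      ((hf.lintegral_kernel (κ := κ)).comp measurable_posReal_inv)

/-- If the normalizing integral is `0` or `∞`, the total mass is `0`. A bound for every `η` is
needed because kernel finiteness is a condition at every point, while barycenters are known only
almost everywhere. -/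
lemma cnMarginal_univ_le_one (η : Measure PosReal) : cnMarginal η Set.univ ≤ 1 := by
  rw [← lintegral_one, lintegral_cnMarginal]
  simp only [mul_one]
  exact ENNReal.inv_mul_le_one _

instance (κ : Kernel PosReal PosReal) : IsFiniteKernel (cnKernel κ) :=
  ⟨1, ENNReal.one_lt_top, fun _ => cnMarginal_univ_le_one _⟩

/-- With `M` the mean of `μ`, the density splits as `x₁ / M = (x₀ / M) * (x₁ / x₀)`: the first
factor reweights `μ`, and the second is the normalized density on the fibre, whose barycenter is
`x₀`. -/
lemma ae_condKernel_cnPlan {μ ν : Measure PosReal} {π : Measure (PosReal × PosReal)}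
    [IsFiniteMeasure π] [IsFiniteMeasure (cnPlan π)] (h : IsMartingalePlan μ ν π) :
    ∀ᵐ x ∂μ, (cnPlan π).condKernel x⁻¹ = cnMarginal (π.condKernel x) := by
  have hp := isMartingalePlan_iff.1 h
  have hp' : IsPlan id (cnMarginal μ) (cnMarginal ν) (cnPlan π) :=
    hp.cnJoint measurable_id measurable_posReal_inv inv_involutive fun _ => rfl
  have hM : ∫⁻ x, ENNReal.ofReal (x : ℝ) ∂μ = _ := hp.lintegral_source measurable_id
  have : IsFiniteMeasure (cnMarginal μ) := hp'.fst_eq ▸ inferInstance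
  have hc := eq_condKernel_of_measure_eq_compProd (ρ := cnPlan π) (cnKernel π.condKernel) (by
    refine Measure.ext_of_lintegral _ fun f hf => ?_
    have hf' : Measurable fun p : PosReal × PosReal =>
        ENNReal.ofReal (p.2 : ℝ) * f (p.1⁻¹, p.2⁻¹) :=
      measurable_snd.ofReal_coe.mul (hf.comp (measurable_prodMap_inv measurable_posReal_inv))
    rw [Measure.lintegral_compProd hf, hp'.fst_eq, lintegral_cnMarginal, hM]
    refine (lintegral_cnJoint measurable_posReal_inv inv_involutive π f).trans ?_
    rw [← Measure.lintegral_condKernel hf', h.fst_eq]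
    congr 1
    refine lintegral_congr_ae ?_
    have hm := h.martingale
    rw [h.fst_eq] at hm
    filter_upwards [hm] with x hx
    rw [bary_eq_iff] at hx
    change _ = _ * ∫⁻ y, f (x⁻¹, y) ∂(cnMarginal (π.condKernel x⁻¹⁻¹))
    rw [inv_inv, lintegral_cnMarginal, hx, ← mul_assoc,
      ENNReal.mul_inv_cancel (ofReal_coe_ne_zero x) ENNReal.ofReal_ne_top, one_mul])
  rw [hp'.fst_eq, ae_cnMarginal_iff (hM ▸ hp.lintegral_snd)] at hc
  filter_upwards [hc] with x hx
  rw [← hx]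
  change cnMarginal (π.condKernel x⁻¹⁻¹) = _
  rw [inv_inv]

end CondKernel

end Shadow

namespace Shadow

/-! ### Transfer of optimality, uniqueness and source types -/

section ShadowCoupling

variable {μ ν : Measure PosReal} {π : Measure (PosReal × PosReal)}
  {σ : Measure (PosReal × unitInterval)}

lemma IsMartingalePlan.cnPlan (h : IsMartingalePlan μ ν π) :
    IsMartingalePlan (cnMarginal μ) (cnMarginal ν) (cnPlan π) :=
  isMartingalePlan_iff.2 ((isMartingalePlan_iff.1 h).cnJoint measurable_id
    measurable_posReal_inv inv_involutive fun _ => rfl)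

lemma cnPlan_cnPlan (h : IsMartingalePlan μ ν π) : cnPlan (cnPlan π) = π := by
  have := h.prob
  exact cnJoint_cnJoint measurable_posReal_inv inv_involutive
    (isMartingalePlan_iff.1 h).lintegral_snd

lemma planCost_cnPlan [IsProbabilityMeasure σ] [IsFiniteMeasure (cnSource σ)]
    [IsFiniteMeasure π] [IsFiniteMeasure (cnPlan π)] (h : IsMartingalePlan μ ν π)
    (hσ : σ.fst = μ) :
    planCost (cnMarginal μ) (cnSource σ) (cnPlan π) =
      (∫⁻ x, ENNReal.ofReal (x : ℝ) ∂μ)⁻¹ * planCost μ σ π := by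
  have hp := isMartingalePlan_iff.1 h
  have hM : ∫⁻ x, ENNReal.ofReal (x : ℝ) ∂μ ≠ ∞ :=
    (hp.lintegral_source measurable_id).trans_ne hp.lintegral_snd
  have hMσ : ∫⁻ x, ENNReal.ofReal (x : ℝ) ∂μ = ∫⁻ q, ENNReal.ofReal (q.1 : ℝ) ∂σ :=
    hσ ▸ lintegral_map measurable_ofReal_coe measurable_fst
  rw [planCost, lintegral_cnMarginal, planCost]
  congr 1
  have hm := h.martingale
  rw [h.fst_eq] at hm
  refine lintegral_congr_ae ?_
  filter_upwards [hm, ae_condKernel_cnPlan h, hσ ▸ ae_condKernel_cnSource (hMσ ▸ hM)]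
    with x hx hπ hs
  rw [hπ]
  exact ofReal_mul_sourceCost ((bary_eq_iff _ _).1 hx) hs

lemma IsSource.cnSource (h : IsSource σ) : IsSource (cnSource σ) := by
  have := h.prob
  have hM := (integrable_coe_iff measurable_fst).1 h.integrable_fst
  refine ⟨isProbabilityMeasure_changeNumeraire measurable_fst measurable_inv_fst
    involutive_inv_fst hM, (integrable_coe_iff measurable_fst).2 ?_, fun u => ?_⟩
  · rw [Shadow.cnSource, lintegral_coe_changeNumeraire measurable_fst measurable_inv_fst
      involutive_inv_fst fun _ => rfl]
    exact ENNReal.inv_ne_top.2 (lintegral_coe_ne_zero measurable_fst)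
  · have hu := h.noAtoms u
    rw [Measure.snd_apply (measurableSet_singleton u), measure_eq_zero_iff_ae_notMem] at hu ⊢
    -- Null sets are preserved and `u` is fixed by the transformation, so no atom can appear.
    exact (ae_changeNumeraire_iff measurable_fst measurable_inv_fst involutive_inv_fst hM).2 hu

lemma shadowValue_le [IsFiniteMeasure σ] [hp : IsProbabilityMeasure π]
    (h : IsMartingalePlan μ ν π) : shadowValue μ ν σ ≤ planCost μ σ π := by
  rw [shadowValue]
  exact iInf_le_of_le π (iInf₂_le hp h)

theorem IsShadowCoupling.cnPlan (h : IsShadowCoupling μ ν σ π) :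
    IsShadowCoupling (cnMarginal μ) (cnMarginal ν) (cnSource σ) (cnPlan π) := by
  have := h.source_prob
  have := h.plan_prob
  have hs := h.source.cnSource
  have := hs.prob
  have hπ := h.plan.cnPlan
  have := hπ.prob
  have hp := isMartingalePlan_iff.1 h.plan
  have hμ : IsProbabilityMeasure μ := h.source_fst ▸ inferInstance
  have hν : IsProbabilityMeasure ν := h.plan.snd_eq ▸ inferInstance
  have hM : ∫⁻ x, ENNReal.ofReal (x : ℝ) ∂μ ≠ ∞ :=
    (hp.lintegral_source measurable_id).trans_ne hp.lintegral_snd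
  have hM0 : ∫⁻ x, ENNReal.ofReal (x : ℝ) ∂μ ≠ 0 := lintegral_coe_ne_zero measurable_id
  -- Every competitor of the transformed problem is an image, by involutivity; both the lower bound
  -- on the value and uniqueness rest on this.
  have hsurj : ∀ π', IsMartingalePlan (cnMarginal μ) (cnMarginal ν) π' →
      ∃ π₀, IsMartingalePlan μ ν π₀ ∧ Shadow.cnPlan π₀ = π' := fun π' h' => by
    refine ⟨Shadow.cnPlan π', ?_, cnPlan_cnPlan h'⟩
    have h'' := h'.cnPlan
    rwa [cnMarginal_cnMarginal hM,
      cnMarginal_cnMarginal (hp.lintegral_target.trans_ne hp.lintegral_snd)] at h''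
  have hV : shadowValue (cnMarginal μ) (cnMarginal ν) (cnSource σ) =
      (∫⁻ x, ENNReal.ofReal (x : ℝ) ∂μ)⁻¹ * shadowValue μ ν σ := by
    refine le_antisymm ?_ ?_
    · rw [← h.optimal, ← planCost_cnPlan h.plan h.source_fst]
      exact shadowValue_le hπ
    · refine le_iInf fun π' => le_iInf fun hp' => le_iInf fun h' => ?_
      obtain ⟨π₀, h₀, rfl⟩ := hsurj π' h'
      have := h₀.prob
      rw [planCost_cnPlan h₀ h.source_fst]
      exact mul_le_mul_right (shadowValue_le h₀) _
  refine ⟨hs.prob, hπ.prob, hs, ?_, hπ, ?_, ?_⟩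
  · rw [fst_cnSource, h.source_fst]
  · rw [hV, planCost_cnPlan h.plan h.source_fst, h.optimal]
  · intro π' hp' h' hopt
    obtain ⟨π₀, h₀, rfl⟩ := hsurj π' h'
    have := h₀.prob
    -- The scaling factor is neither `0` nor `∞`, so it cancels and `π₀` is optimal for the original
    -- problem.
    rw [planCost_cnPlan h₀ h.source_fst, hV,
      ENNReal.mul_right_inj (ENNReal.inv_ne_zero.2 hM) (ENNReal.inv_ne_top.2 hM0)] at hopt
    rw [h.unique π₀ h₀ hopt]

lemma cnSource_compl_eq_zero (hσ : ∫⁻ q, ENNReal.ofReal (q.1 : ℝ) ∂σ ≠ ∞)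
    {Γ : Set (PosReal × unitInterval)} (hΓ : σ Γᶜ = 0) :
    cnSource σ {q | (q.1⁻¹, q.2) ∈ Γ}ᶜ = 0 := by
  refine (ae_changeNumeraire_iff measurable_fst measurable_inv_fst involutive_inv_fst hσ
    (P := fun q => (q.1⁻¹, q.2) ∈ Γ)).2 ?_
  simp only [inv_inv, Prod.mk.eta]
  exact hΓ

lemma IsMonotoneSource.cnSource (h : IsMonotoneSource σ)
    (hσ : ∫⁻ q, ENNReal.ofReal (q.1 : ℝ) ∂σ ≠ ∞) : IsAntitoneSource (cnSource σ) := by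
  obtain ⟨Γ, hΓ, hm⟩ := h
  refine ⟨_, cnSource_compl_eq_zero hσ hΓ, fun p hp q hq hpq => ?_⟩
  exact inv_le_inv_iff.1 (hm hp hq hpq)

lemma IsAntitoneSource.cnSource (h : IsAntitoneSource σ)
    (hσ : ∫⁻ q, ENNReal.ofReal (q.1 : ℝ) ∂σ ≠ ∞) : IsMonotoneSource (cnSource σ) := by
  obtain ⟨Γ, hΓ, hm⟩ := h
  refine ⟨_, cnSource_compl_eq_zero hσ hΓ, fun p hp q hq hpq => ?_⟩
  exact inv_le_inv_iff.1 (hm hp hq hpq)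

lemma cnSource_eq_prod (h : IsSource σ) (hprod : σ = σ.fst.prod σ.snd) :
    cnSource σ = (cnSource σ).fst.prod (cnSource σ).snd := by
  have := h.prob
  have := h.cnSource.prob
  have : IsProbabilityMeasure (cnMarginal σ.fst) := fst_cnSource σ ▸ inferInstance
  have hs : cnSource σ = (cnMarginal σ.fst).prod σ.snd := by
    conv_lhs => rw [hprod]
    exact cnSource_prod _ _
  rw [hs, Measure.fst_prod, Measure.snd_prod]

lemma IsShadowCoupling.lintegral_source_ne_top (h : IsShadowCoupling μ ν σ π) :
    ∫⁻ q, ENNReal.ofReal (q.1 : ℝ) ∂σ ≠ ∞ :=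
  (integrable_coe_iff measurable_fst).1 h.source.integrable_fst

end ShadowCoupling

end Shadow

theorem mainTheorem7 (μ ν : Measure PosReal) (π : Measure (PosReal × PosReal)) :
    (∀ σ : Measure (PosReal × unitInterval), Shadow.IsShadowCoupling μ ν σ π →
      Shadow.IsShadowCoupling (Shadow.cnMarginal μ) (Shadow.cnMarginal ν) (Shadow.cnSource σ)
        (Shadow.cnPlan π)) ∧
    (Shadow.IsLeftMonotone μ ν π →
      Shadow.IsRightMonotone (Shadow.cnMarginal μ) (Shadow.cnMarginal ν) (Shadow.cnPlan π)) ∧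
    (Shadow.IsRightMonotone μ ν π →
      Shadow.IsLeftMonotone (Shadow.cnMarginal μ) (Shadow.cnMarginal ν) (Shadow.cnPlan π)) ∧
    (Shadow.IsSunset μ ν π →
      Shadow.IsSunset (Shadow.cnMarginal μ) (Shadow.cnMarginal ν) (Shadow.cnPlan π)) := by
  refine ⟨fun σ h => h.cnPlan, ?_, ?_, ?_⟩
  · rintro ⟨σ, hσ, h⟩
    exact ⟨_, hσ.cnSource h.lintegral_source_ne_top, h.cnPlan⟩
  · rintro ⟨σ, hσ, h⟩
    exact ⟨_, hσ.cnSource h.lintegral_source_ne_top, h.cnPlan⟩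
  · rintro ⟨σ, hσ, h⟩
    exact ⟨_, Shadow.cnSource_eq_prod h.source hσ, h.cnPlan⟩
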